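/- Fix $T>0$ and $\lambda>0$. For each $N\ge 1$ let $X^N=(X^N(t))_{t\in[0,T]}$ be the continuous-time Markov process on $\{1,\dots,N\}$ with generator $$G^Nf(m)=\lambda m\,\bigl(f(m+1)-f(m)\bigr)\mathbf 1_{\{m<N\}}+\lambda m\,\bigl(f(m-1)-f(m)\bigr)\mathbf 1_{\{m>1\}},$$ with right-continuous piecewise constant trajectories with finitely many jumps, all equal to $\pm1$, and with initial distribution equal to the stationary distribution $$\pi^N(m)=\frac{1/m}{\sum_{k=1}^N 1/k},\qquad m=1,\dots,N .$$ Let $\xi^N_{\mathbf{st}}(t)=X^N(t)/N$, and let $\boldsymbol\zeta$ be the process concentrated on the path that is identically zero on $[0,T]$. Let $\mathbf D^N[0,T]$ be the set of right-continuous piecewise constant functions $[0,T]\to\{\frac1N,\dots,\frac NN\}$ with finitely many jumps, all equal to $\pm\frac1N$, and let $\bar{\mathbf D}[0,T]$ be the completion of $\bigcup_N\mathbf D^N[0,T]$ in the uniform metric. Then: 1. $\xi^N_{\mathbf{st}}\Rightarrow\boldsymbol\zeta$ weakly in $\bar{\mathbf D}[0,T]$ as $N\to\infty$, that is, $\mathbf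 E\,F(\xi^N_{\mathbf{st}})\to \mathbf E\,F(\boldsymbol\zeta)=F(0)$ for every bounded functional $F:\bar{\mathbf D}[0,T]\to\mathbb R$ which is continuous in the uniform metric and measurable with respect to the $\sigma$-algebra generated by the coordinate maps. 2. For every $\ell\ge 0$ and all $u_1,\dots,u_\ell\in(0,1]$, $$\lim_{N\to\infty}\int_0^T\!\!\cdots\!\int_0^T\mathbf P\Bigl(\bigcap_{i=1}^\ell\{\xi^N_{\mathbf{st}}(t_i)<u_i\}\Bigr)\,dt_1\cdots dt_\ell=\int_0^T\!\!\cdots\!\int_0^T\mathbf P\Bigl(\bigcap_{i=1}^\ell\{\boldsymbol\zeta(t_i)<u_i\}\Bigr)\,dt_1\cdots dt_\ell=T^\ell .$$ -/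

import Mathlib

open MeasureTheory Filter Topology
open scoped UniformConvergence

noncomputable section

namespace LinearBirthDeath

/-- The state space `{1, …, N}`. -/
abbrev State (N : ℕ) : Type := ↥(Finset.Icc 1 N)

/-- The time interval `[0, T]`. -/
abbrev Time (T : ℝ) : Type := ↥(Set.Icc (0 : ℝ) T)

/-- Lebesgue measure on `[0, T]`. -/
def timeMeasure (T : ℝ) : Measure (Time T) :=
  (volume : Measure ℝ).comap Subtype.val

/-- The generator
`G f (m) = lam m (f (m+1) - f m) 1_{m < N} + lam m (f (m-1) - f m) 1_{m > 1}`
on functions on `{1, …, N}`. -/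
def generator (lam : ℝ) (N : ℕ) : (State N → ℝ) →ₗ[ℝ] (State N → ℝ) where
  toFun f m :=
    (if h : m.1 < N then
      lam * m.1 * (f ⟨m.1 + 1, Finset.mem_Icc.2 ⟨Nat.le_add_left 1 m.1, h⟩⟩ - f m) else 0) +
    (if h : 1 < m.1 then
      lam * m.1 * (f ⟨m.1 - 1, Finset.mem_Icc.2
        ⟨Nat.le_sub_one_of_lt h, (Nat.sub_le _ _).trans (Finset.mem_Icc.1 m.2).2⟩⟩ - f m) else 0)
  map_add' f g := by
    funext m
    simp only [Pi.add_apply]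
    split_ifs <;> ring
  map_smul' c f := by
    funext m
    simp only [Pi.smul_apply, smul_eq_mul, RingHom.id_apply]
    split_ifs <;> ring

/-- The transition probabilities `p_t(x, y) = (exp (t G))(x, y)`, where the matrix of `G` is
`G(x, y) = (G 1_y)(x)`. -/
def transition (lam : ℝ) (N : ℕ) (t : ℝ) : Matrix (State N) (State N) ℝ :=
  NormedSpace.exp (t • LinearMap.toMatrix' (generator lam N))

/-- The stationary distribution `π(m) = (1/m) / ∑_{k=1}^N 1/k`. -/
def stationary (N : ℕ) (m : State N) : ℝ :=
  (1 / (m.1 : ℝ)) / ∑ k ∈ Finset.Icc 1 N, 1 / (k : ℝ)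

/-- The trajectories of the chain on `[0, T]`: right-continuous step functions with finitely many
jumps, at times `0 < s 1 < ⋯ < s k ≤ T`, between neighbouring states
(`x` equals `m i` from the time `s i` until the next jump time). -/
def trajectories (N : ℕ) (T : ℝ) : Set (Time T → State N) :=
  {x | ∃ (k : ℕ) (s : Fin (k + 1) → Time T) (m : Fin (k + 1) → State N),
    StrictMono s ∧ (s 0).1 = 0 ∧
    (∀ i : Fin k, (m i.succ).1 = (m i.castSucc).1 + 1 ∨ (m i.castSucc).1 = (m i.succ).1 + 1) ∧
    ∀ (t : Time T) (i : Fin (k + 1)), s i ≤ t → (∀ j, i < j → t < s j) → x t = m i}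

/-- The scaled path `t ↦ x t / N`, as an element of the space of all functions `[0, T] → ℝ`
with the uniform structure of uniform convergence. -/
def scalePath {N : ℕ} {T : ℝ} (x : Time T → State N) : Time T →ᵤ ℝ :=
  UniformFun.ofFun fun t => ((x t).1 : ℝ) / N

/-- The set of trajectories of the scaled process, with steps of size `1/N`. -/
def scaledTrajectories (N : ℕ) (T : ℝ) : Set (Time T →ᵤ ℝ) :=
  scalePath '' trajectories N T

/-- The path space: the completion, in the uniform metric, of the union over `N` of the sets of
scaled trajectories (realised as the closure in the complete space of all functions
`[0, T] → ℝ`). It carries the topology of uniform convergence. -/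
abbrev PathSpace (T : ℝ) : Type :=
  ↥(closure (⋃ N : ℕ, scaledTrajectories N T) : Set (Time T →ᵤ ℝ))

/-- The value of a path at a time. -/
def PathSpace.eval {T : ℝ} (γ : PathSpace T) (t : Time T) : ℝ :=
  UniformFun.toFun γ.1 t

/-- The σ-algebra on the path space generated by the coordinate maps `γ ↦ γ(t)`. -/
instance PathSpace.measurableSpace (T : ℝ) : MeasurableSpace (PathSpace T) :=
  MeasurableSpace.comap (fun γ t => PathSpace.eval γ t) MeasurableSpace.pi

theorem const_mem_trajectories {T : ℝ} (hT : 0 ≤ T) {N : ℕ} (m : State N) :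
    (fun _ : Time T => m) ∈ trajectories N T :=
  ⟨0, fun _ => ⟨0, le_refl 0, hT⟩, fun _ => m,
    fun a b h => absurd h (by omega), rfl,
    fun i => i.elim0, fun _ _ _ _ => rfl⟩

theorem zero_mem_closure {T : ℝ} (hT : 0 ≤ T) :
    (UniformFun.ofFun (fun _ => 0) : Time T →ᵤ ℝ) ∈
      closure (⋃ N : ℕ, scaledTrajectories N T) := by
  have hmem : ∀ n : ℕ, 1 ∈ Finset.Icc 1 (n + 1) := fun n => Finset.mem_Icc.2 (by omega)
  refine mem_closure_of_tendsto (b := (atTop : Filter ℕ))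
    (f := fun n : ℕ => scalePath (T := T) (fun _ => (⟨1, hmem n⟩ : State (n + 1)))) ?_ ?_
  · rw [UniformFun.tendsto_iff_tendstoUniformly, Metric.tendstoUniformly_iff]
    intro ε hε
    have h := tendsto_one_div_add_atTop_nhds_zero_nat (𝕜 := ℝ)
    filter_upwards [h.eventually (Metric.ball_mem_nhds 0 hε)] with n hn t
    have hn' : dist (0 : ℝ) (1 / ((n : ℝ) + 1)) < ε := by
      rw [dist_comm]
      exact hn
    simpa [scalePath] using hn'
  · exact Eventually.of_forall fun n =>
      Set.mem_iUnion.2 ⟨n + 1, _, const_mem_trajectories hT _, rfl⟩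

/-- The path identically equal to zero. -/
def zeroPath {T : ℝ} (hT : 0 ≤ T) : PathSpace T :=
  ⟨UniformFun.ofFun (fun _ => 0), zero_mem_closure hT⟩

/-- `X` is, under the probability measure `P`, a Markov process on `{1, …, N}` over the time
interval `[0, T]` with the above generator, with piecewise constant trajectories and with
initial distribution `π`. The law is given through the finite-dimensional distributions. -/
structure IsStationaryChain (lam : ℝ) (N : ℕ) {T : ℝ} {Ω : Type*} [MeasurableSpace Ω]
    (P : Measure Ω) (X : Time T → Ω → State N) : Prop where
  measurable : ∀ t, Measurable (X t)
  trajectory : ∀ᵐ ω ∂P, (fun t => X t ω) ∈ trajectories N T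
  markov : ∀ (n : ℕ) (t : Fin (n + 1) → Time T) (x : Fin (n + 1) → State N), Monotone t →
    P.real {ω | ∀ i, X (t i) ω = x i} =
      P.real {ω | X (t 0) ω = x 0} *
        ∏ i : Fin n, transition lam N ((t i.succ).1 - (t i.castSucc).1)
          (x i.castSucc) (x i.succ)
  initial : ∀ t : Time T, t.1 = 0 → ∀ m, P.real {ω | X t ω = m} = stationary N m

/-- `ξ` is the scaled process `ξ(t) = X(t) / N`, where `X` is the chain on `{1, …, N}` started
from the distribution `π`, regarded as a random element of the path space. -/
def IsScaledStationaryProcess (lam : ℝ) (N : ℕ) {T : ℝ} {Ω : Type*} [MeasurableSpace Ω]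
    (P : Measure Ω) (ξ : Ω → PathSpace T) : Prop :=
  Measurable ξ ∧ ∃ X : Time T → Ω → State N, IsStationaryChain lam N P X ∧
    ∀ᵐ ω ∂P, ∀ t, (ξ ω).eval t = ((X t ω).1 : ℝ) / N

/-- Weak convergence of measures on the path space: convergence of the integrals of all bounded
functionals that are continuous in the uniform metric and measurable with respect to the
σ-algebra generated by the coordinate maps. -/
def ConvergesWeakly {T : ℝ} (μ : ℕ → Measure (PathSpace T)) (ν : Measure (PathSpace T)) : Prop :=
  ∀ F : PathSpace T → ℝ, Continuous F → Measurable F → (∃ C : ℝ, ∀ γ, |F γ| ≤ C) →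
    Tendsto (fun N => ∫ γ, F γ ∂(μ N)) atTop (𝓝 (∫ γ, F γ ∂ν))

end LinearBirthDeath

end

namespace LinearBirthDeath

/-! ### Exponentials of matrices with nonnegative off-diagonal entries -/

section MatrixExponential

variable {n : Type*} [Fintype n] [DecidableEq n]

attribute [local instance] Matrix.linftyOpNormedRing Matrix.linftyOpNormedAlgebra

/-! The state has drift at most `lam`: jumps up and down balance in the interior, and only the lower
boundary pushes upwards. So `X(t) - lam t` is a supermartingale, and a Doob-type maximal inequality
bounds the probability that `X` ever reaches `a` by `(E X(0) + lam T) / a`. Under `π` the mean is `N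
/ H_N`, where `H_N` is the harmonic sum, so `a = δ N` gives `(1 / H_N + lam T / N) / δ`, which tends
to zero. Only this mean and the total mass of `π` enter; its invariance is not needed.

The inequality is proved on finite time grids from the finite-dimensional laws
(`sum_prod_transition_le`) and passes to all times by right-continuity
(`IsStationaryChain.measure_exists_le`). The resulting uniform convergence in probability
(`tendsto_measure_exists_le_abs`) yields both claims. -/

theorem exp_apply_nonneg_of_nonneg {A : Matrix n n ℝ} (hA : ∀ i j, 0 ≤ A i j) (i j : n) :
    0 ≤ NormedSpace.exp A i j := by
  have hpow : ∀ (k : ℕ) (i j : n), 0 ≤ (A ^ k) i j := by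
    intro k
    induction k with
    | zero => intro i j; rw [pow_zero, Matrix.one_apply]; split_ifs <;> norm_num
    | succ k ih =>
      intro i j
      rw [pow_succ, Matrix.mul_apply]
      exact Finset.sum_nonneg fun l _ => mul_nonneg (ih i l) (hA l j)
  have h := NormedSpace.exp_series_hasSum_exp' (𝕂 := ℝ) A
  have h' := (Pi.hasSum.1 (Pi.hasSum.1 h i)) j
  refine h'.nonneg fun k => ?_
  exact mul_nonneg (by positivity) (hpow k i j)

/-- Adding a large multiple `c` of the identity makes every entry nonnegative, and since scalar
matrices commute with `A` it only multiplies the exponential by `Real.exp c`. -/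
theorem exp_apply_nonneg_of_offDiag_nonneg {A : Matrix n n ℝ} (hA : ∀ i j, i ≠ j → 0 ≤ A i j)
    (i j : n) : 0 ≤ NormedSpace.exp A i j := by
  obtain ⟨c, hc⟩ : ∃ c : ℝ, ∀ i, 0 ≤ A i i + c :=
    ⟨∑ k, |A k k|, fun i => by
      have h := Finset.single_le_sum (f := fun k => |A k k|) (fun _ _ => abs_nonneg _)
        (Finset.mem_univ i)
      have := neg_abs_le (A i i)
      linarith⟩
  have hsplit : A = (-c) • (1 : Matrix n n ℝ) + (A + c • (1 : Matrix n n ℝ)) := by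
    rw [neg_smul]; abel
  have hcomm : Commute ((-c) • (1 : Matrix n n ℝ)) (A + c • (1 : Matrix n n ℝ)) :=
    (Commute.one_left _).smul_left _
  have hscalar : NormedSpace.exp ((-c) • (1 : Matrix n n ℝ)) =
      Real.exp (-c) • (1 : Matrix n n ℝ) := by
    have h := NormedSpace.algebraMap_exp_comm (𝕂 := ℝ) (𝔸 := Matrix n n ℝ) (-c)
    rw [Algebra.algebraMap_eq_smul_one, Algebra.algebraMap_eq_smul_one, ← Real.exp_eq_exp_ℝ] at h
    exact h.symm
  have hexp : NormedSpace.exp A =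
      Real.exp (-c) • NormedSpace.exp (A + c • (1 : Matrix n n ℝ)) := by
    conv_lhs => rw [hsplit]
    rw [Matrix.exp_add_of_commute _ _ hcomm, hscalar, smul_mul_assoc, one_mul]
  rw [hexp, Matrix.smul_apply]
  refine mul_nonneg (Real.exp_pos _).le (exp_apply_nonneg_of_nonneg (fun i j => ?_) i j)
  by_cases hij : i = j
  · subst hij; simpa using hc i
  · simpa [Matrix.one_apply, hij] using hA i j hij

/-- Dynkin's formula with an inequality: the derivative of `exp (s A) f` is `exp (s A) (A f)`, an
average of values at most `c`, because the rows of `exp (s A)` are nonnegative and sum to one. The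
mean value inequality concludes. -/
theorem exp_smul_mulVec_le {A : Matrix n n ℝ} (hA : ∀ i j, i ≠ j → 0 ≤ A i j)
    {f : n → ℝ} {c : ℝ} (hf : ∀ i, (A.mulVec f) i ≤ c)
    (hone : A.mulVec 1 = 0) {t : ℝ} (ht : 0 ≤ t) (i : n) :
    ((NormedSpace.exp (t • A)).mulVec f) i ≤ f i + c * t := by
  have hderiv : ∀ (g : n → ℝ) (s : ℝ),
      HasDerivAt (fun s : ℝ => ((NormedSpace.exp (s • A)).mulVec g) i)
        (((NormedSpace.exp (s • A)).mulVec (A.mulVec g)) i) s := by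
    intro g s
    let L : Matrix n n ℝ →ₗ[ℝ] ℝ :=
      { toFun := fun M => M.mulVec g i
        map_add' := fun M M' => by simp [Matrix.add_mulVec]
        map_smul' := fun r M => by simp [Matrix.smul_mulVec] }
    have h := (LinearMap.toContinuousLinearMap L).hasFDerivAt.comp_hasDerivAt s
      (hasDerivAt_exp_smul_const (𝕂 := ℝ) A s)
    rw [Matrix.mulVec_mulVec]
    exact h
  have hsum : ∀ s : ℝ, ((NormedSpace.exp (s • A)).mulVec 1) i = 1 := by
    intro s
    have h := is_const_of_deriv_eq_zero (f := fun s : ℝ => ((NormedSpace.exp (s • A)).mulVec 1) i)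
      (fun s => (hderiv 1 s).differentiableAt)
      (fun s => by rw [(hderiv 1 s).deriv, hone]; simp) s 0
    simpa using h
  have hle : ∀ s : ℝ, 0 ≤ s → ((NormedSpace.exp (s • A)).mulVec (A.mulVec f)) i ≤ c := by
    intro s hs
    calc ((NormedSpace.exp (s • A)).mulVec (A.mulVec f)) i
        ≤ ((NormedSpace.exp (s • A)).mulVec (c • (1 : n → ℝ))) i := by
          refine Finset.sum_le_sum fun j _ => mul_le_mul_of_nonneg_left ?_ ?_
          · simpa using hf j
          · exact exp_apply_nonneg_of_offDiag_nonneg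
              (fun a b hab => mul_nonneg hs (hA a b hab)) i j
      _ = c := by rw [Matrix.mulVec_smul, Pi.smul_apply, hsum s, smul_eq_mul, mul_one]
  have h := (convex_Ici (0 : ℝ)).image_sub_le_mul_sub_of_deriv_le
    (f := fun s : ℝ => ((NormedSpace.exp (s • A)).mulVec f) i)
    (fun s _ => (hderiv f s).continuousAt.continuousWithinAt)
    (fun s _ => (hderiv f s).differentiableAt.differentiableWithinAt)
    (C := c)
    (fun s hs => by
      rw [interior_Ici] at hs
      rw [(hderiv f s).deriv]
      exact hle s (le_of_lt hs)) 0 (Set.self_mem_Ici) t ht ht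
  simp only [zero_smul, NormedSpace.exp_zero, Matrix.one_mulVec, sub_zero] at h
  linarith

end MatrixExponential

/-! ### Drift of the chain and the maximal inequality for transition weights -/

section Transition

variable {lam : ℝ} {N : ℕ}

theorem generator_matrix_nonneg (hlam : 0 ≤ lam) {x y : State N} (hxy : x ≠ y) :
    0 ≤ LinearMap.toMatrix' (generator lam N) x y := by
  rw [LinearMap.toMatrix'_apply]
  simp only [generator, LinearMap.coe_mk, AddHom.coe_mk, Pi.single_apply, if_neg hxy, sub_zero]
  refine add_nonneg ?_ ?_ <;> split_ifs <;> positivity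

theorem generator_matrix_mulVec (f : State N → ℝ) :
    (LinearMap.toMatrix' (generator lam N)).mulVec f = generator lam N f := by
  rw [LinearMap.toMatrix'_mulVec]

theorem generator_one : generator lam N 1 = 0 := by
  funext m
  simp [generator]

/-- The two jump terms cancel in the interior, the top state has nonpositive drift, and the state 1
has drift at most `lam` since its downward jump is suppressed. -/
theorem generator_val_le (hlam : 0 ≤ lam) (m : State N) :
    generator lam N (fun x => (x.1 : ℝ)) m ≤ lam := by
  have h1 : 1 ≤ m.1 := (Finset.mem_Icc.1 m.2).1
  have h1' : (1 : ℝ) ≤ m.1 := by exact_mod_cast h1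
  have hm : 0 ≤ lam * m.1 := by positivity
  simp only [generator, LinearMap.coe_mk, AddHom.coe_mk]
  by_cases h2 : 1 < m.1
  · rw [dif_pos h2, Nat.cast_sub h1]
    split_ifs <;> push_cast <;> nlinarith
  · have hm1 : m.1 = 1 := by omega
    rw [dif_neg h2, hm1]
    split_ifs <;> push_cast <;> nlinarith

theorem transition_nonneg (hlam : 0 ≤ lam) {t : ℝ} (ht : 0 ≤ t) (x y : State N) :
    0 ≤ transition lam N t x y :=
  exp_apply_nonneg_of_offDiag_nonneg
    (fun _ _ h => mul_nonneg ht (generator_matrix_nonneg hlam h)) x y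

theorem sum_transition_le_one (hlam : 0 ≤ lam) {t : ℝ} (ht : 0 ≤ t) (x : State N) :
    ∑ y, transition lam N t x y ≤ 1 := by
  have h := exp_smul_mulVec_le (A := LinearMap.toMatrix' (generator lam N))
    (fun _ _ h => generator_matrix_nonneg hlam h) (f := 1) (c := 0)
    (fun i => by rw [generator_matrix_mulVec, generator_one]; rfl)
    (by rw [generator_matrix_mulVec, generator_one]) ht x
  simpa [Matrix.mulVec, dotProduct, transition] using h

theorem sum_transition_mul_val_le (hlam : 0 ≤ lam) {t : ℝ} (ht : 0 ≤ t) (x : State N) :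
    ∑ y, transition lam N t x y * (y.1 : ℝ) ≤ x.1 + lam * t :=
  exp_smul_mulVec_le (A := LinearMap.toMatrix' (generator lam N))
    (fun _ _ h => generator_matrix_nonneg hlam h) (f := fun x => (x.1 : ℝ))
    (fun i => by rw [generator_matrix_mulVec]; exact generator_val_le hlam i)
    (by rw [generator_matrix_mulVec, generator_one]) ht x

/-- The weight of the paths that reach level `a` along the time grid `t`, when started
from `x`, is at most that of a nonnegative supermartingale. -/
theorem sum_prod_transition_le (hlam : 0 ≤ lam) {a : ℝ} (ha : 0 < a) :
    ∀ (n : ℕ) (t : Fin (n + 1) → ℝ), Monotone t → ∀ x : State N,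
      (∑ y : Fin n → State N, ∏ i : Fin n, transition lam N (t i.succ - t i.castSucc)
          ((Fin.cons x y : Fin (n + 1) → State N) i.castSucc) (y i) ≤ 1) ∧
      ∑ y : Fin n → State N,
        (if ∃ i, a ≤ (((Fin.cons x y : Fin (n + 1) → State N) i).1 : ℝ) then
          ∏ i : Fin n, transition lam N (t i.succ - t i.castSucc)
          ((Fin.cons x y : Fin (n + 1) → State N) i.castSucc) (y i) else 0) ≤
        (x.1 + lam * (t (Fin.last n) - t 0)) / a := by
  intro n
  induction n with
  | zero =>
    intro t ht x
    refine ⟨by simp, ?_⟩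
    simp only [Finset.univ_unique, Finset.sum_singleton, Finset.univ_eq_empty, Finset.prod_empty]
    have hx : (0 : ℝ) ≤ x.1 := Nat.cast_nonneg _
    split_ifs with h
    · obtain ⟨i, hi⟩ := h
      rw [Fin.fin_one_eq_zero i, Fin.cons_zero] at hi
      rw [le_div_iff₀ ha]
      simpa using hi
    · simpa using div_nonneg hx ha.le
  | succ n ih =>
    intro t ht x
    have h01 : 0 ≤ t 1 - t 0 := sub_nonneg.2 (ht (Fin.zero_le _))
    have hprod : ∀ (y : State N) (z : Fin n → State N),
        ∏ i : Fin (n + 1), transition lam N (t i.succ - t i.castSucc)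
          ((Fin.cons x (Fin.cons y z : Fin (n + 1) → State N) : Fin (n + 2) → State N) i.castSucc)
          ((Fin.cons y z : Fin (n + 1) → State N) i) =
        transition lam N (t 1 - t 0) x y * ∏ i : Fin n,
          transition lam N (t i.succ.succ - t i.succ.castSucc)
            ((Fin.cons y z : Fin (n + 1) → State N) i.castSucc) (z i) := by
      intro y z
      rw [Fin.prod_univ_succ]
      rfl
    have htail : Monotone fun i : Fin (n + 1) => t i.succ :=
      fun i j h => ht (Fin.succ_le_succ_iff.2 h)
    have hsum : ∀ g : (Fin (n + 1) → State N) → ℝ,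
        ∑ y, g y = ∑ y : State N, ∑ z : Fin n → State N, g (Fin.cons y z) := by
      intro g
      rw [← (Fin.consEquiv fun _ => State N).sum_comp, Fintype.sum_prod_type]
      rfl
    have hone : ∑ y : Fin (n + 1) → State N,
        ∏ i : Fin (n + 1), transition lam N (t i.succ - t i.castSucc)
          ((Fin.cons x y : Fin (n + 2) → State N) i.castSucc) (y i) ≤ 1 := by
      rw [hsum]
      simp only [hprod, ← Finset.mul_sum]
      refine le_trans (Finset.sum_le_sum fun y _ => ?_) (sum_transition_le_one hlam h01 x)
      exact mul_le_of_le_one_right (transition_nonneg hlam h01 x y)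
        (ih (fun i => t i.succ) htail y).1
    refine ⟨hone, ?_⟩
    have hspan : 0 ≤ lam * (t (Fin.last (n + 1)) - t 0) :=
      mul_nonneg hlam (sub_nonneg.2 (ht (Fin.zero_le _)))
    -- If the start is already at the level, the total weight is at most one, which is below the
    -- bound. Otherwise the level must be reached later, and the induction hypothesis is averaged
    -- over the first step.
    by_cases hx : a ≤ (x.1 : ℝ)
    · have hall : ∀ y : Fin (n + 1) → State N,
          ∃ i, a ≤ (((Fin.cons x y : Fin (n + 2) → State N) i).1 : ℝ) := fun y => ⟨0, hx⟩
      simp only [hall, if_true]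
      refine hone.trans ((one_le_div ha).2 (by linarith))
    · have hex : ∀ y : Fin (n + 1) → State N,
          (∃ i, a ≤ (((Fin.cons x y : Fin (n + 2) → State N) i).1 : ℝ)) ↔
            ∃ i, a ≤ ((y i).1 : ℝ) := fun y => by
        rw [Fin.exists_fin_succ]
        simp [hx]
      simp only [hex]
      rw [hsum]
      simp only [hprod, ← mul_ite_zero, ← Finset.mul_sum]
      calc _ ≤ ∑ y : State N, transition lam N (t 1 - t 0) x y *
              ((y.1 + lam * (t (Fin.last (n + 1)) - t 1)) / a) := by
            refine Finset.sum_le_sum fun y _ => mul_le_mul_of_nonneg_left ?_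
              (transition_nonneg hlam h01 x y)
            exact (ih (fun i => t i.succ) htail y).2
        _ = (∑ y : State N, transition lam N (t 1 - t 0) x y * (y.1 : ℝ) +
              (∑ y : State N, transition lam N (t 1 - t 0) x y) *
                (lam * (t (Fin.last (n + 1)) - t 1))) / a := by
            rw [Finset.sum_mul, ← Finset.sum_add_distrib, Finset.sum_div]
            exact Finset.sum_congr rfl fun y _ => by ring
        -- The first step raises the mean by at most `lam * (t 1 - t 0)`, which adds up with the
        -- remaining drift.
        _ ≤ _ := by
            have h1 := sum_transition_mul_val_le hlam h01 x
            have h2 : 0 ≤ lam * (t (Fin.last (n + 1)) - t 1) :=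
              mul_nonneg hlam (sub_nonneg.2 (ht (Fin.le_last _)))
            have h3 := mul_le_of_le_one_left h2 (sum_transition_le_one hlam h01 x)
            exact div_le_div_of_nonneg_right (by linarith) ha.le

end Transition

end LinearBirthDeath
namespace LinearBirthDeath

/-! ### Right-continuity and time grids -/

section Trajectories

variable {N : ℕ} {T : ℝ}

theorem eventually_eq_of_mem_trajectories {x : Time T → State N} (hx : x ∈ trajectories N T)
    (t : Time T) : ∀ᶠ u in 𝓝[≥] t, x u = x t := by
  obtain ⟨k, s, m, -, hs0, -, hval⟩ := hx
  have hne : (Finset.univ.filter fun i => s i ≤ t).Nonempty :=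
    ⟨0, by
      simp only [Finset.mem_filter, Finset.mem_univ, true_and]
      exact Subtype.coe_le_coe.1 (hs0.le.trans t.2.1)⟩
  -- `i` is the index of the last jump not after `t`; the next jump is strictly later, so the path
  -- is constant just after `t`.
  obtain ⟨i, hi, hmax⟩ := Finset.exists_maximal hne
  have hit : s i ≤ t := (Finset.mem_filter.1 hi).2
  have hlt : ∀ j, i < j → t < s j := by
    intro j hij
    by_contra h
    exact absurd (hmax (Finset.mem_filter.2 ⟨Finset.mem_univ j, not_lt.1 h⟩) hij.le)
      (not_le.2 hij)
  have hnear : ∀ᶠ u in 𝓝 t, ∀ j, i < j → u < s j :=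
    eventually_all.2 fun j => by
      by_cases hij : i < j
      · filter_upwards [eventually_lt_nhds (hlt j hij)] with u hu _ using hu
      · exact Eventually.of_forall fun _ h => absurd h hij
  filter_upwards [nhdsWithin_le_nhds hnear, self_mem_nhdsWithin] with u hu hut
  rw [hval u i (hit.trans hut) hu, hval t i hit hlt]

/-- The grid `0, T / (n + 1), …, T`. -/
noncomputable def grid (hT : 0 ≤ T) (n : ℕ) (i : Fin (n + 2)) : Time T :=
  ⟨T * (i.1 / (n + 1)), by positivity, mul_le_of_le_one_right hT <| by
    rw [div_le_one (by positivity)]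
    exact_mod_cast Nat.lt_succ_iff.1 i.2⟩

theorem grid_monotone (hT : 0 ≤ T) (n : ℕ) : Monotone (grid hT n) := by
  intro i j hij
  refine Subtype.coe_le_coe.1 (mul_le_mul_of_nonneg_left ?_ hT)
  have : (i.1 : ℝ) ≤ j.1 := by exact_mod_cast hij
  gcongr

/-- The first grid point not before `t` tends to `t` from the right, and the path is constant on a
right neighbourhood of `t`. -/
theorem eventually_exists_grid_eq (hT : 0 < T) {x : Time T → State N}
    (hx : x ∈ trajectories N T) (t : Time T) :
    ∀ᶠ n in atTop, ∃ i, x (grid hT.le n i) = x t := by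
  have hceil : ∀ n : ℕ, ⌈(n + 1) * (t.1 / T)⌉₊ < n + 2 := fun n =>
    Nat.lt_succ_iff.2 <| Nat.ceil_le.2 <| by
      push_cast
      exact mul_le_of_le_one_right (by positivity) ((div_le_one hT).2 t.2.2)
  let i : ∀ n : ℕ, Fin (n + 2) := fun n => ⟨_, hceil n⟩
  have hpos : ∀ n : ℕ, (0 : ℝ) < n + 1 := fun n => by positivity
  have hge : ∀ n, t ≤ grid hT.le n (i n) := by
    intro n
    refine Subtype.coe_le_coe.1 ?_
    have h := Nat.le_ceil (((n : ℝ) + 1) * (t.1 / T))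
    change t.1 ≤ T * ((⌈(n + 1) * (t.1 / T)⌉₊ : ℝ) / (n + 1))
    rw [← div_le_iff₀' hT, le_div_iff₀' (hpos n)]
    exact h
  have hle : ∀ n, (grid hT.le n (i n)).1 ≤ t.1 + T * (1 / ((n : ℝ) + 1)) := by
    intro n
    have h := (Nat.ceil_lt_add_one
      (mul_nonneg (hpos n).le (div_nonneg t.2.1 hT.le))).le
    change T * ((⌈(n + 1) * (t.1 / T)⌉₊ : ℝ) / (n + 1)) ≤ _
    calc T * ((⌈(n + 1) * (t.1 / T)⌉₊ : ℝ) / (n + 1))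
        ≤ T * (((n + 1) * (t.1 / T) + 1) / (n + 1)) := by gcongr
      _ = _ := by field_simp
  have hlim : Tendsto (fun n => grid hT.le n (i n)) atTop (𝓝[≥] t) := by
    refine tendsto_nhdsWithin_iff.2 ⟨?_, Eventually.of_forall hge⟩
    refine tendsto_subtype_rng.2 ?_
    refine tendsto_of_tendsto_of_tendsto_of_le_of_le tendsto_const_nhds ?_
      (fun n => Subtype.coe_le_coe.2 (hge n)) hle
    simpa using (tendsto_one_div_add_atTop_nhds_zero_nat (𝕜 := ℝ)).const_mul T |>.const_add t.1
  filter_upwards [hlim.eventually (eventually_eq_of_mem_trajectories hx t)] with n hn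
  exact ⟨i n, hn⟩

end Trajectories

/-! ### The maximal inequality for the process -/

section MaximalInequality

variable {lam : ℝ} {N : ℕ} {T : ℝ} {Ω : Type*} [MeasurableSpace Ω] {P : Measure Ω}

/-- The weight `1/m` cancels the value `m`, so all `N` states contribute equally. -/
theorem sum_stationary_mul_val (N : ℕ) :
    ∑ m : State N, stationary N m * (m.1 : ℝ) = N / ∑ k ∈ Finset.Icc 1 N, 1 / (k : ℝ) := by
  have h : ∀ m : State N, stationary N m * (m.1 : ℝ) =
      1 / ∑ k ∈ Finset.Icc 1 N, 1 / (k : ℝ) := by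
    intro m
    have hm : (m.1 : ℝ) ≠ 0 := by
      have := (Finset.mem_Icc.1 m.2).1
      positivity
    rw [stationary, div_mul_eq_mul_div, one_div_mul_cancel hm]
  simp only [h, Finset.sum_const, Finset.card_univ, Fintype.card_coe, Nat.card_Icc,
    nsmul_eq_mul, Nat.add_sub_cancel]
  rw [mul_one_div]

/-- The event is split according to the states at the grid times; the Markov property turns each
piece into an initial weight times a product of transitions. -/
theorem IsStationaryChain.measureReal_exists_grid_le [IsProbabilityMeasure P] (hlam : 0 ≤ lam)
    {X : Time T → Ω → State N} (hX : IsStationaryChain lam N P X) {a : ℝ} (ha : 0 < a)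
    {n : ℕ} {t : Fin (n + 1) → Time T} (ht : Monotone t) (ht0 : (t 0).1 = 0) :
    P.real {ω | ∃ i, a ≤ ((X (t i) ω).1 : ℝ)} ≤
      (N / (∑ k ∈ Finset.Icc 1 N, 1 / (k : ℝ)) + lam * T) / a := by
  classical
  let w : (Fin (n + 1) → State N) → ℝ := fun y =>
    if ∃ i, a ≤ ((y i).1 : ℝ) then P.real {ω | ∀ i, X (t i) ω = y i} else 0
  have hcover : {ω | ∃ i, a ≤ ((X (t i) ω).1 : ℝ)} ⊆
      ⋃ y ∈ Finset.univ.filter (fun y : Fin (n + 1) → State N => ∃ i, a ≤ ((y i).1 : ℝ)),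
        {ω | ∀ i, X (t i) ω = y i} := by
    intro ω hω
    simp only [Set.mem_iUnion]
    exact ⟨fun i => X (t i) ω, Finset.mem_filter.2 ⟨Finset.mem_univ _, hω⟩, fun _ => rfl⟩
  have h1 : P.real {ω | ∃ i, a ≤ ((X (t i) ω).1 : ℝ)} ≤ ∑ y, w y := by
    refine (measureReal_mono hcover (measure_ne_top _ _)).trans ((measureReal_biUnion_finset_le _ _).trans ?_)
    rw [Finset.sum_filter]
  have hsum : ∑ y, w y = ∑ x : State N, ∑ z : Fin n → State N, w (Fin.cons x z) := by
    rw [← (Fin.consEquiv fun _ => State N).sum_comp, Fintype.sum_prod_type]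
    rfl
  have hnonneg : ∀ x, 0 ≤ stationary N x := fun x => by unfold stationary; positivity
  have ht' : Monotone fun i => (t i).1 := fun i j h => ht h
  have hlast : lam * ((t (Fin.last n)).1 - (t 0).1) ≤ lam * T := by
    rw [ht0, sub_zero]
    exact mul_le_mul_of_nonneg_left (t _).2.2 hlam
  have hmass : ∑ x, stationary N x ≤ 1 := by
    have : ∑ x, stationary N x = ∑ x : State N, P.real (X (t 0) ⁻¹' {x}) :=
      Finset.sum_congr rfl fun x _ => (hX.initial _ ht0 x).symm
    rw [this, sum_measureReal_preimage_singleton _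
      fun y _ => hX.measurable _ (measurableSet_singleton y)]
    exact measureReal_le_one
  calc P.real {ω | ∃ i, a ≤ ((X (t i) ω).1 : ℝ)}
      ≤ ∑ x : State N, ∑ z : Fin n → State N, w (Fin.cons x z) := h1.trans hsum.le
    _ ≤ ∑ x : State N, stationary N x * ((x.1 + lam * T) / a) := by
        refine Finset.sum_le_sum fun x _ => ?_
        have h := (sum_prod_transition_le hlam ha n _ ht' x).2
        refine le_trans (le_of_eq ?_) (mul_le_mul_of_nonneg_left (h.trans ?_) (hnonneg x))
        · rw [Finset.mul_sum]
          refine Finset.sum_congr rfl fun z _ => ?_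
          rw [mul_ite_zero]
          refine if_congr Iff.rfl ?_ rfl
          rw [hX.markov n t _ ht, Fin.cons_zero, hX.initial _ ht0]
          rfl
        · exact div_le_div_of_nonneg_right (by linarith) ha.le
    _ = (∑ x : State N, stationary N x * x.1 + (∑ x, stationary N x) * (lam * T)) / a := by
        rw [Finset.sum_mul, ← Finset.sum_add_distrib, Finset.sum_div]
        exact Finset.sum_congr rfl fun y _ => by ring
    _ ≤ _ := by
        rw [sum_stationary_mul_val]
        have hT : 0 ≤ T := (t 0).2.1.trans (t 0).2.2
        have := mul_le_of_le_one_left (mul_nonneg hlam hT) hmass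
        exact div_le_div_of_nonneg_right (by linarith) ha.le

/-- The grids are not nested, so the event is covered, almost surely, by the limit inferior of the
grid events. Continuity from below along the increasing intersections then needs no measurability of
the event over all times. -/
theorem IsStationaryChain.measure_exists_le [IsProbabilityMeasure P] (hlam : 0 ≤ lam)
    (hT : 0 < T) {X : Time T → Ω → State N} (hX : IsStationaryChain lam N P X)
    {a : ℝ} (ha : 0 < a) :
    P {ω | ∃ t, a ≤ ((X t ω).1 : ℝ)} ≤
      ENNReal.ofReal ((N / (∑ k ∈ Finset.Icc 1 N, 1 / (k : ℝ)) + lam * T) / a) := by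
  let A : ℕ → Set Ω := fun n => {ω | ∃ i, a ≤ ((X (grid hT.le n i) ω).1 : ℝ)}
  have hmono : Monotone fun n => ⋂ k ≥ n, A k := fun n n' h =>
    Set.biInter_mono (fun k hk => le_trans h hk) fun _ _ => le_rfl
  have hcover : {ω | ∃ t, a ≤ ((X t ω).1 : ℝ)} ≤ᵐ[P] ⋃ n, ⋂ k ≥ n, A k := by
    filter_upwards [hX.trajectory] with ω hω
    rintro ⟨t, ht⟩
    obtain ⟨n, hn⟩ := eventually_atTop.1 (eventually_exists_grid_eq hT hω t)
    refine Set.mem_iUnion.2 ⟨n, Set.mem_iInter₂.2 fun k hk => ?_⟩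
    obtain ⟨i, hi⟩ := hn k hk
    exact ⟨i, by rw [hi]; exact ht⟩
  refine (measure_mono_ae hcover).trans ?_
  rw [hmono.measure_iUnion]
  refine iSup_le fun n => (measure_mono (Set.biInter_subset_of_mem (le_refl n))).trans ?_
  rw [← ofReal_measureReal]
  exact ENNReal.ofReal_le_ofReal
    (hX.measureReal_exists_grid_le hlam ha (grid_monotone hT.le n) (by simp [grid]))

theorem IsScaledStationaryProcess.measure_exists_le_abs [IsProbabilityMeasure P] (hlam : 0 ≤ lam)
    (hT : 0 < T) (hN : 1 ≤ N) {ξ : Ω → PathSpace T}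
    (hξ : IsScaledStationaryProcess lam N P ξ) {δ : ℝ} (hδ : 0 < δ) :
    P {ω | ∃ t, δ ≤ |(ξ ω).eval t|} ≤
      ENNReal.ofReal (((∑ k ∈ Finset.Icc 1 N, 1 / (k : ℝ))⁻¹ + lam * T * (N : ℝ)⁻¹) / δ) := by
  obtain ⟨-, X, hX, heq⟩ := hξ
  have hN' : (0 : ℝ) < N := by exact_mod_cast hN
  have hcover : {ω | ∃ t, δ ≤ |(ξ ω).eval t|} ≤ᵐ[P] {ω | ∃ t, δ * N ≤ ((X t ω).1 : ℝ)} := by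
    filter_upwards [heq] with ω hω
    rintro ⟨t, ht⟩
    refine ⟨t, ?_⟩
    rw [hω t, abs_of_nonneg (by positivity), le_div_iff₀ hN'] at ht
    exact ht
  refine (measure_mono_ae hcover).trans
    ((hX.measure_exists_le hlam hT (mul_pos hδ hN')).trans (le_of_eq ?_))
  congr 1
  field_simp

end MaximalInequality

theorem tendsto_sum_Icc_one_div_atTop :
    Tendsto (fun N : ℕ => ∑ k ∈ Finset.Icc 1 N, 1 / (k : ℝ)) atTop atTop := by
  refine Real.tendsto_sum_range_one_div_nat_succ_atTop.congr fun N => ?_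
  rw [← Finset.Ico_add_one_right_eq_Icc, Finset.sum_Ico_eq_sum_range]
  refine Finset.sum_congr rfl fun i _ => ?_
  push_cast
  rw [add_comm]

/-! ### Passage to the limit -/

section Limit

variable {lam T : ℝ} {Ω : ℕ → Type*} [∀ N, MeasurableSpace (Ω N)]
  {P : ∀ N, Measure (Ω N)} [∀ N, IsProbabilityMeasure (P N)] {ξ : ∀ N, Ω N → PathSpace T}

/-- The stationary scaled processes converge to zero in probability, uniformly in time. -/
theorem tendsto_measure_exists_le_abs (hlam : 0 ≤ lam) (hT : 0 < T)
    (hξ : ∀ N, 1 ≤ N → IsScaledStationaryProcess lam N (P N) (ξ N)) {δ : ℝ} (hδ : 0 < δ) :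
    Tendsto (fun N => P N {ω | ∃ t, δ ≤ |(ξ N ω).eval t|}) atTop (𝓝 0) := by
  have hbound : Tendsto (fun N : ℕ => ENNReal.ofReal
      (((∑ k ∈ Finset.Icc 1 N, 1 / (k : ℝ))⁻¹ + lam * T * (N : ℝ)⁻¹) / δ)) atTop (𝓝 0) := by
    have h := (((tendsto_inv_atTop_zero.comp tendsto_sum_Icc_one_div_atTop).add
      ((tendsto_inv_atTop_nhds_zero_nat (𝕜 := ℝ)).const_mul (lam * T))).div_const δ)
    have h' := ENNReal.tendsto_ofReal h
    simpa using h'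
  refine tendsto_of_tendsto_of_tendsto_of_le_of_le' tendsto_const_nhds hbound
    (Eventually.of_forall fun _ => zero_le) ?_
  filter_upwards [eventually_ge_atTop 1] with N hN
  exact (hξ N hN).measure_exists_le_abs hlam hT hN hδ

theorem exists_forall_abs_eval_lt_imp (hT : 0 ≤ T) {F : PathSpace T → ℝ} (hF : Continuous F)
    {ε : ℝ} (hε : 0 < ε) :
    ∃ δ > 0, ∀ γ : PathSpace T, (∀ t, |γ.eval t| < δ) → |F γ - F (zeroPath hT)| < ε := by
  have h := hF.continuousAt.eventually (Metric.ball_mem_nhds (F (zeroPath hT)) hε)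
  rw [nhds_subtype, Filter.eventually_comap] at h
  obtain ⟨V, hV, hsub⟩ := (UniformFun.hasBasis_nhds (Time T) ℝ (zeroPath hT).1).mem_iff.1 h
  obtain ⟨δ, hδ, hδV⟩ := Metric.mem_uniformity_dist.1 hV
  refine ⟨δ, hδ, fun γ hγ => ?_⟩
  have hmem : (γ.1 : Time T →ᵤ ℝ) ∈ {g | ((zeroPath hT).1, g) ∈ UniformFun.gen (Time T) ℝ V} := by
    intro t
    refine hδV ?_
    rw [dist_comm, Real.dist_eq]
    change |γ.eval t - 0| < δ
    rw [sub_zero]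
    exact hγ t
  exact hsub hmem γ rfl

theorem convergesWeakly_dirac_zeroPath (hT : 0 ≤ T)
    (hmeas : ∀ᶠ N in atTop, Measurable (ξ N))
    (hlim : ∀ δ > 0, Tendsto (fun N => P N {ω | ∃ t, δ ≤ |(ξ N ω).eval t|}) atTop (𝓝 0)) :
    ConvergesWeakly (fun N => (P N).map (ξ N)) (Measure.dirac (zeroPath hT)) := by
  rintro F hF hFm ⟨C, hC⟩
  rw [integral_dirac' _ _ hFm.stronglyMeasurable, Metric.tendsto_atTop']
  intro ε hε
  obtain ⟨δ, hδ, hFδ⟩ := exists_forall_abs_eval_lt_imp hT hF (half_pos hε)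
  have hC0 : 0 ≤ C := (abs_nonneg _).trans (hC (zeroPath hT))
  have hreal : Tendsto (fun N => 2 * C * (P N).real {ω | ∃ t, δ ≤ |(ξ N ω).eval t|}) atTop
      (𝓝 0) := by
    simpa [Measure.real] using
      (((ENNReal.tendsto_toReal ENNReal.zero_ne_top).comp (hlim δ hδ)).const_mul (2 * C))
  have hev : ∀ᶠ N in atTop, dist (∫ γ, F γ ∂(P N).map (ξ N)) (F (zeroPath hT)) < ε := by
    filter_upwards [hmeas, hreal.eventually (gt_mem_nhds (half_pos hε))] with N hN hsmall
    have hFξ : Measurable fun ω => F (ξ N ω) := hFm.comp hN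
    rw [integral_map hN.aemeasurable hFm.aestronglyMeasurable]
    have hint : Integrable (fun ω => F (ξ N ω)) (P N) :=
      Integrable.of_bound hFξ.aestronglyMeasurable C (Eventually.of_forall fun ω => hC _)
    -- `S` replaces the supremum event, which need not be measurable; it is measurable because `F`
    -- is. The error is at most `ε / 2` off `S` and `2 * C` on it.
    let S : Set (Ω N) := {ω | ε / 2 ≤ |F (ξ N ω) - F (zeroPath hT)|}
    have hS : MeasurableSet S :=
      measurableSet_le measurable_const (hFξ.sub_const _).abs
    have hSsub : S ⊆ {ω | ∃ t, δ ≤ |(ξ N ω).eval t|} := by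
      intro ω hω
      by_contra h
      exact absurd (hFδ (ξ N ω) fun t => not_le.1 fun ht => h ⟨t, ht⟩) (not_lt.2 hω)
    have hdiff : ∫ ω, F (ξ N ω) ∂P N - F (zeroPath hT) =
        ∫ ω, (F (ξ N ω) - F (zeroPath hT)) ∂P N := by
      rw [integral_sub hint (integrable_const _), integral_const]
      simp
    have hpt : ∀ ω, |F (ξ N ω) - F (zeroPath hT)| ≤ ε / 2 + S.indicator (fun _ => 2 * C) ω := by
      intro ω
      by_cases hω : ω ∈ S
      · rw [Set.indicator_of_mem hω]
        have := abs_sub (F (ξ N ω)) (F (zeroPath hT))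
        linarith [hC (ξ N ω), hC (zeroPath hT)]
      · rw [Set.indicator_of_notMem hω, add_zero]
        exact (not_le.1 hω).le
    have hintS : Integrable (S.indicator fun _ => 2 * C) (P N) :=
      (integrable_const _).indicator hS
    rw [Real.dist_eq, hdiff]
    calc |∫ ω, (F (ξ N ω) - F (zeroPath hT)) ∂P N|
        ≤ ∫ ω, |F (ξ N ω) - F (zeroPath hT)| ∂P N := abs_integral_le_integral_abs
      _ ≤ ∫ ω, (ε / 2 + S.indicator (fun _ => 2 * C) ω) ∂P N :=
          integral_mono (hint.sub (integrable_const _)).abs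
            ((integrable_const _).add hintS) hpt
      _ = ε / 2 + 2 * C * (P N).real S := by
          rw [integral_add (integrable_const _) hintS, integral_indicator_const _ hS]
          simp [mul_comm]
      _ ≤ ε / 2 + 2 * C * (P N).real {ω | ∃ t, δ ≤ |(ξ N ω).eval t|} := by
          have := measureReal_mono (μ := P N) hSsub
          gcongr
      _ < ε := by linarith
  obtain ⟨n, hn⟩ := eventually_atTop.1 hev
  exact ⟨n, fun N hN => hn N hN.le⟩

theorem measurable_eval (t : Time T) : Measurable fun γ : PathSpace T => γ.eval t :=
  (measurable_pi_apply t).comp (comap_measurable _)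

theorem dirac_zeroPath_forall_eval_lt (hT : 0 ≤ T) {l : ℕ} {u : Fin l → ℝ}
    (hu : ∀ i, 0 < u i) (t : Fin l → Time T) :
    Measure.dirac (zeroPath hT) {γ | ∀ i, γ.eval (t i) < u i} = 1 := by
  have hmeas : MeasurableSet {γ : PathSpace T | ∀ i, γ.eval (t i) < u i} := by
    rw [Set.ofPred_forall]
    exact MeasurableSet.iInter fun i => measurableSet_lt (measurable_eval _) measurable_const
  rw [Measure.dirac_apply' _ hmeas]
  have hmem : zeroPath hT ∈ {γ : PathSpace T | ∀ i, γ.eval (t i) < u i} := fun i => hu i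
  rw [Set.indicator_of_mem hmem, Pi.one_apply]

theorem timeMeasure_univ (T : ℝ) : timeMeasure T Set.univ = ENNReal.ofReal T := by
  rw [timeMeasure, comap_subtype_coe_apply measurableSet_Icc, Set.image_univ, Subtype.range_coe,
    Real.volume_Icc, sub_zero]

instance isFiniteMeasure_timeMeasure (T : ℝ) : IsFiniteMeasure (timeMeasure T) :=
  ⟨by rw [timeMeasure_univ]; exact ENNReal.ofReal_lt_top⟩

theorem pi_timeMeasure_univ (T : ℝ) (l : ℕ) :
    (Measure.pi fun _ : Fin l => timeMeasure T) Set.univ = ENNReal.ofReal T ^ l := by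
  rw [Measure.pi_univ]
  simp [timeMeasure_univ]

/-- For `δ` below all `u i`, the integrand lies between `1 - P(sup ≥ δ)` and 1 for every `t`, so the
integrals are squeezed without exchanging limits or checking measurability in `t`. -/
theorem tendsto_lintegral_forall_eval_lt
    (hmeas : ∀ᶠ N in atTop, Measurable (ξ N))
    (hlim : ∀ δ > 0, Tendsto (fun N => P N {ω | ∃ t, δ ≤ |(ξ N ω).eval t|}) atTop (𝓝 0))
    {l : ℕ} {u : Fin l → ℝ} (hu : ∀ i, 0 < u i) :
    Tendsto (fun N => ∫⁻ t : Fin l → Time T, P N {ω | ∀ i, (ξ N ω).eval (t i) < u i}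
      ∂(Measure.pi fun _ => timeMeasure T)) atTop (𝓝 (ENNReal.ofReal T ^ l)) := by
  obtain ⟨δ, hδ, hδu⟩ : ∃ δ > 0, ∀ i, δ ≤ u i := by
    -- Taking `δ` near zero rather than as a minimum also covers `l = 0`.
    have h : ∀ᶠ δ in 𝓝[>] (0 : ℝ), ∀ i, δ ≤ u i :=
      eventually_all.2 fun i => nhdsWithin_le_nhds (eventually_le_nhds (hu i))
    obtain ⟨δ, h, hδ⟩ := (h.and self_mem_nhdsWithin).exists
    exact ⟨δ, hδ, h⟩
  have hlow : Tendsto (fun N => (1 - P N {ω | ∃ t, δ ≤ |(ξ N ω).eval t|}) *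
      ENNReal.ofReal T ^ l) atTop (𝓝 (ENNReal.ofReal T ^ l)) := by
    have h := ENNReal.Tendsto.mul_const (b := ENNReal.ofReal T ^ l)
      (ENNReal.Tendsto.sub (tendsto_const_nhds (x := 1)) (hlim δ hδ)
        (Or.inl ENNReal.one_ne_top)) (Or.inr (ENNReal.pow_ne_top ENNReal.ofReal_ne_top))
    simpa using h
  refine tendsto_of_tendsto_of_tendsto_of_le_of_le' hlow tendsto_const_nhds ?_ ?_
  · filter_upwards [hmeas] with N hN
    rw [← pi_timeMeasure_univ, ← lintegral_const]
    refine lintegral_mono fun t => ?_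
    have hset : MeasurableSet {ω | ∀ i, (ξ N ω).eval (t i) < u i} := by
      rw [Set.ofPred_forall]
      exact MeasurableSet.iInter fun i =>
        measurableSet_lt ((measurable_eval _).comp hN) measurable_const
    have hcompl : {ω | ∀ i, (ξ N ω).eval (t i) < u i}ᶜ ⊆ {ω | ∃ t, δ ≤ |(ξ N ω).eval t|} := by
      intro ω hω
      simp only [Set.mem_compl_iff, Set.mem_ofPred_eq, not_forall, not_lt] at hω
      obtain ⟨i, hi⟩ := hω
      exact ⟨t i, (hδu i).trans (hi.trans (le_abs_self _))⟩
    rw [tsub_le_iff_right, ← measure_univ (μ := P N), ← measure_add_measure_compl hset]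
    gcongr
  · refine Eventually.of_forall fun N => ?_
    calc _ ≤ ∫⁻ _ : Fin l → Time T, 1 ∂(Measure.pi fun _ => timeMeasure T) :=
          lintegral_mono fun t => prob_le_one
      _ = _ := by rw [lintegral_const, one_mul, pi_timeMeasure_univ]

end Limit

end LinearBirthDeath

theorem mainTheorem3 (lam : ℝ) (hlam : 0 < lam) (T : ℝ) (hT : 0 < T)
    {Ω : ℕ → Type*} [∀ N, MeasurableSpace (Ω N)]
    (P : ∀ N, Measure (Ω N)) [∀ N, IsProbabilityMeasure (P N)]
    (ξ : ∀ N, Ω N → LinearBirthDeath.PathSpace T)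
    (hξ : ∀ N, 1 ≤ N → LinearBirthDeath.IsScaledStationaryProcess lam N (P N) (ξ N)) :
    LinearBirthDeath.ConvergesWeakly (fun N => (P N).map (ξ N))
        (Measure.dirac (LinearBirthDeath.zeroPath hT.le)) ∧
      ∀ (l : ℕ) (u : Fin l → ℝ), (∀ i, 0 < u i ∧ u i ≤ 1) →
        Tendsto
          (fun N => ∫⁻ t : Fin l → LinearBirthDeath.Time T,
            P N {ω | ∀ i, (ξ N ω).eval (t i) < u i}
              ∂(Measure.pi fun _ => LinearBirthDeath.timeMeasure T))
          atTop
          (𝓝 (∫⁻ t : Fin l → LinearBirthDeath.Time T,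
            Measure.dirac (LinearBirthDeath.zeroPath hT.le) {γ | ∀ i, γ.eval (t i) < u i}
              ∂(Measure.pi fun _ => LinearBirthDeath.timeMeasure T))) ∧
        ∫⁻ t : Fin l → LinearBirthDeath.Time T,
            Measure.dirac (LinearBirthDeath.zeroPath hT.le) {γ | ∀ i, γ.eval (t i) < u i}
              ∂(Measure.pi fun _ => LinearBirthDeath.timeMeasure T) =
          ENNReal.ofReal T ^ l := by
  have hmeas : ∀ᶠ N in atTop, Measurable (ξ N) :=
    (eventually_ge_atTop 1).mono fun N hN => (hξ N hN).1
  have hlim := fun δ (hδ : (0 : ℝ) < δ) =>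
    LinearBirthDeath.tendsto_measure_exists_le_abs hlam.le hT hξ hδ
  refine ⟨LinearBirthDeath.convergesWeakly_dirac_zeroPath hT.le hmeas hlim, fun l u hu => ?_⟩
  have hzero : ∫⁻ t : Fin l → LinearBirthDeath.Time T,
      Measure.dirac (LinearBirthDeath.zeroPath hT.le) {γ | ∀ i, γ.eval (t i) < u i}
        ∂(Measure.pi fun _ => LinearBirthDeath.timeMeasure T) = ENNReal.ofReal T ^ l := by
    simp only [LinearBirthDeath.dirac_zeroPath_forall_eval_lt hT.le fun i => (hu i).1]
    rw [lintegral_const, one_mul, LinearBirthDeath.pi_timeMeasure_univ]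
  rw [hzero]
  exact ⟨LinearBirthDeath.tendsto_lintegral_forall_eval_lt hmeas hlim fun i => (hu i).1, rfl⟩
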